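/- Let $K$ be a nonarchimedean local field (a nontrivially valued, locally compact field with nonarchimedean absolute value $|\cdot|$), with ring of integers $\mathcal O=\{x\in K:|x|\le 1\}$ and residue field of size $q$. Let $C(\mathcal O,K)$ be the $K$-Banach algebra of continuous functions $\mathcal O\to K$ with the sup-norm. Let $K\langle X_0,X_1,\dots\rangle$ be the $K$-algebra of formal power series $f=\sum_i a_i\underline X^i$ in the variables $X_0,X_1,\dots$ ($i$ ranging over the finitely supported sequences of natural numbers) such that for every $\varepsilon>0$ one has $|a_i|<\varepsilon$ for all but finitely many $i$, with the norm $|f|=\sup_i|a_i|$. Let $I_q(K)$ be the closure of the ideal generated by all $X_j^q-X_j$ ($j\ge 0$), and equip $K\langle X_0,X_1,\dots\rangle/I_q(K)$ with the residue norm $|f \bmod I_q(K)|=\inf_{h\in I_q(K)}|f+h|$. For a uniformizer $\pi$ of $\mathcal O$ and $x\in\mathcal O$, let $x=\sum_{j\ge0}\omega_{j,\pi}(x)\pi^j$ be the unique expansion in which every $\omega_{j,\pi}(x)\in\mathcal O$ is a Teichmüller representative, i.e. $\omega_{j,\pi}(x)^q=\omega_{j,\pi}(x)$. Then $\mathcal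 O$ has a uniformizer, $K\langle X_0,X_1,\dots\rangle/I_q(K)$ is complete, and for every uniformizer $\pi$ of $\mathcal O$ there is an isometric isomorphism of $K$-algebras (hence of $K$-Banach algebras) $$\Psi_\pi\colon K\langle X_0,X_1,\dots\rangle/I_q(K)\;\xrightarrow{\ \sim\ }\;C(\mathcal O,K)$$ that sends the class of $X_j$ to the function $\omega_{j,\pi}$ for every $j\ge0$. The isomorphism depends on the choice of uniformizer: $\Psi_\pi\ne\Psi_{\pi'}$ whenever $\pi\ne\pi'$. -/

import Mathlib

open Filter Topology
open scoped NormedField Valued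

/-! Throughout, a (nonarchimedean) local field is a nontrivially normed field whose absolute value
is nonarchimedean and whose topology is locally compact. Its integer ring is `𝒪[K]`, the closed
unit ball, and its residue field is `𝓀[K]`. -/

section LocalField

variable {K : Type*} [NontriviallyNormedField K] [IsUltrametricDist K] [LocallyCompactSpace K]

/-- The integer ring of a local field is compact, so `C(𝒪[K], K)` carries the sup-norm. -/
instance instCompactSpaceLocalFieldInteger : CompactSpace 𝒪[K] := by
  have : ProperSpace K := .of_nontriviallyNormedField_of_weaklyLocallyCompactSpace K
  refine isCompact_iff_compactSpace.mp ?_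
  have h : ((𝒪[K] : Subring K) : Set K) = Metric.closedBall 0 1 := by
    ext x
    simp [Valued.integer.mem_iff]
  rw [h]
  exact isCompact_closedBall 0 1

theorem localField_dvr_and_finite :
    IsDiscreteValuationRing 𝒪[K] ∧ Finite 𝓀[K] := by
  let _ : (Valued.v (R := K)).RankOne :=
    inferInstanceAs (NormedField.valuation (K := K)).RankOne
  exact (Valued.integer.compactSpace_iff_completeSpace_and_isDiscreteValuationRing_and_finite_residueField.mp
    (inferInstanceAs (CompactSpace 𝒪[K]))).2

/-- `a` is the sequence of digits of a Teichmüller expansion of `x` with respect to `π`: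
every `a j` is a Teichmüller representative, i.e. a solution of `z ^ q = z` with `q` the size of
the residue field, and `x = ∑ j, a j * π ^ j`. -/
def IsTeichmullerExpansion (π x : 𝒪[K]) (a : ℕ → 𝒪[K]) : Prop :=
  (∀ j, a j ^ Nat.card 𝓀[K] = a j) ∧ HasSum (fun j => a j * π ^ j) x

theorem dvd_iff_norm_lt_one {π : 𝒪[K]} (hπ : Irreducible π) (x : 𝒪[K]) :
    ‖x‖ < 1 ↔ π ∣ x := by
  have := (localField_dvr_and_finite (K := K)).1
  rw [← Ideal.mem_span_singleton, ← hπ.maximalIdeal_eq, IsLocalRing.mem_maximalIdeal,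
    mem_nonunits_iff, Valued.integer.isUnit_iff_norm_eq_one]
  exact ⟨fun h => h.ne, fun h => lt_of_le_of_ne (Valued.integer.norm_le_one x) h⟩

theorem residue_eq_iff_norm (a b : 𝒪[K]) :
    IsLocalRing.residue 𝒪[K] a = IsLocalRing.residue 𝒪[K] b ↔ ‖a - b‖ < 1 := by
  rw [← sub_eq_zero, ← map_sub, IsLocalRing.residue_eq_zero_iff, IsLocalRing.mem_maximalIdeal,
    mem_nonunits_iff, Valued.integer.isUnit_iff_norm_eq_one]
  exact ⟨fun h => lt_of_le_of_ne (Valued.integer.norm_le_one _) h, fun h => h.ne⟩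

theorem norm_le_of_dvd {π x : 𝒪[K]} (h : π ∣ x) : ‖x‖ ≤ ‖π‖ := by
  obtain ⟨y, rfl⟩ := h
  calc ‖π * y‖ ≤ ‖π‖ * ‖y‖ := norm_mul_le _ _
    _ ≤ ‖π‖ := mul_le_of_le_one_right (norm_nonneg _) (Valued.integer.norm_le_one y)

theorem norm_pow_card_sub_le {π : 𝒪[K]} (hπ : Irreducible π) {a b : 𝒪[K]} (h : ‖a - b‖ < 1) :
    ‖a ^ Nat.card 𝓀[K] - b ^ Nat.card 𝓀[K]‖ ≤ ‖π‖ * ‖a - b‖ := by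
  have := (localField_dvr_and_finite (K := K)).2
  have := Fintype.ofFinite 𝓀[K]
  rw [← (Commute.all a b).geom_sum₂_mul]
  refine (norm_mul_le _ _).trans (mul_le_mul_of_nonneg_right ?_ (norm_nonneg _))
  refine norm_le_of_dvd ((dvd_iff_norm_lt_one hπ _).mp ?_)
  rw [← sub_zero (Finset.sum _ _), ← residue_eq_iff_norm]
  simp only [map_sum, map_mul, map_pow, (residue_eq_iff_norm a b).mpr h, map_zero]
  rw [geom_sum₂_self, Nat.card_eq_fintype_card, Nat.cast_card_eq_zero, zero_mul]

theorem teichmuller_eq_of_norm_lt {π : 𝒪[K]} (hπ : Irreducible π) {a b : 𝒪[K]}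
    (ha : a ^ Nat.card 𝓀[K] = a) (hb : b ^ Nat.card 𝓀[K] = b) (h : ‖a - b‖ < 1) : a = b := by
  have h1 := norm_pow_card_sub_le hπ h
  rw [ha, hb] at h1
  have h2 := Valued.integer.norm_irreducible_lt_one hπ
  rw [← sub_eq_zero, ← norm_eq_zero]
  nlinarith [norm_nonneg (a - b)]

theorem norm_pow_card_sub_self_lt (x : 𝒪[K]) : ‖x ^ Nat.card 𝓀[K] - x‖ < 1 := by
  have := (localField_dvr_and_finite (K := K)).2
  have := Fintype.ofFinite 𝓀[K]
  rw [← residue_eq_iff_norm, map_pow, Nat.card_eq_fintype_card, FiniteField.pow_card]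

theorem exists_teichmuller_add_mul {π : 𝒪[K]} (hπ : Irreducible π) (x : 𝒪[K]) :
    ∃ z y : 𝒪[K], z ^ Nat.card 𝓀[K] = z ∧ x = z + π * y := by
  set q := Nat.card 𝓀[K] with hq
  have hπ1 := Valued.integer.norm_irreducible_lt_one hπ
  let u : ℕ → 𝒪[K] := fun n => (fun y => y ^ q)^[n] x
  have hu : ∀ n, u (n + 1) = u n ^ q := fun n => Function.iterate_succ_apply' _ _ _
  have hd : ∀ n, dist (u n) (u (n + 1)) ≤ 1 * ‖π‖ ^ n := by
    intro n
    induction n with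
    | zero => rw [pow_zero, mul_one, dist_eq_norm]; exact Valued.integer.norm_le_one _
    | succ n ih =>
      rw [hu (n + 1), dist_comm, dist_eq_norm]
      nth_rewrite 2 [hu n]
      refine (norm_pow_card_sub_le hπ ?_).trans ?_
      · rw [hu n]; exact norm_pow_card_sub_self_lt _
      · rw [dist_comm, dist_eq_norm] at ih
        rw [one_mul] at ih ⊢
        rw [pow_succ']
        exact mul_le_mul_of_nonneg_left ih (norm_nonneg _)
  obtain ⟨z, hz⟩ := cauchySeq_tendsto_of_complete (cauchySeq_of_le_geometric _ _ hπ1 hd)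
  have hz1 : z ^ q = z := by
    refine tendsto_nhds_unique (hz.pow q) ?_
    simpa only [hu] using (tendsto_add_atTop_iff_nat 1).mpr hz
  have hclose : ∀ n, IsLocalRing.residue 𝒪[K] (u n) = IsLocalRing.residue 𝒪[K] x := by
    intro n
    induction n with
    | zero => rfl
    | succ n ih => rw [← ih, residue_eq_iff_norm, hu]; exact norm_pow_card_sub_self_lt _
  have hx : ‖x - z‖ ≤ ‖π‖ := by
    refine le_of_tendsto (tendsto_const_nhds.sub hz).norm (Eventually.of_forall fun n => ?_)
    exact norm_le_of_dvd ((dvd_iff_norm_lt_one hπ _).mp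
      ((residue_eq_iff_norm _ _).mp (hclose n).symm))
  obtain ⟨y, hy⟩ := (dvd_iff_norm_lt_one hπ _).mp (hx.trans_lt hπ1)
  exact ⟨z, y, hz1, by rw [← hy]; ring⟩

theorem summable_mul_pow {π : 𝒪[K]} (hπ : Irreducible π) (a : ℕ → 𝒪[K]) :
    Summable fun j => a j * π ^ j := by
  have hπ1 := Valued.integer.norm_irreducible_lt_one hπ
  refine Summable.of_norm_bounded (summable_geometric_of_lt_one (norm_nonneg π) hπ1) fun j => ?_
  refine (norm_mul_le _ _).trans ?_
  rw [← one_mul (‖π‖ ^ j)]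
  exact mul_le_mul (Valued.integer.norm_le_one _) (norm_pow_le _ _) (norm_nonneg _) zero_le_one

theorem exists_isTeichmullerExpansion {π : 𝒪[K]} (hπ : Irreducible π) (x : 𝒪[K]) :
    ∃ a, IsTeichmullerExpansion π x a := by
  choose z y hz hy using exists_teichmuller_add_mul hπ
  let X : ℕ → 𝒪[K] := fun n => y^[n] x
  have hX : ∀ n, X (n + 1) = y (X n) := fun n => Function.iterate_succ_apply' _ _ _
  have hsum : ∀ n, x = ∑ j ∈ Finset.range n, z (X j) * π ^ j + X n * π ^ n := by
    intro n
    induction n with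
    | zero => simp [X]
    | succ n ih =>
      rw [Finset.sum_range_succ, hX]
      nth_rewrite 1 [ih]
      linear_combination π ^ n * hy (X n)
  refine ⟨fun j => z (X j), fun j => hz _, ?_⟩
  rw [(summable_mul_pow hπ _).hasSum_iff_tendsto_nat]
  have h0 : Tendsto (fun n => x - X n * π ^ n) atTop (𝓝 (x - 0)) :=
    tendsto_const_nhds.sub (summable_mul_pow hπ X).tendsto_atTop_zero
  rw [sub_zero] at h0
  refine h0.congr fun n => ?_
  nth_rewrite 1 [hsum n]
  ring

theorem IsTeichmullerExpansion.exists_tail {π x : 𝒪[K]} (hπ : Irreducible π) {a : ℕ → 𝒪[K]}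
    (h : IsTeichmullerExpansion π x a) :
    ∃ y, IsTeichmullerExpansion π y (fun j => a (j + 1)) ∧ x = a 0 + π * y := by
  obtain ⟨y, hy⟩ := summable_mul_pow hπ fun j => a (j + 1)
  refine ⟨y, ⟨fun j => h.1 _, hy⟩, ?_⟩
  have h1 := (hasSum_nat_add_iff' 1).mpr h.2
  have h2 := hy.mul_left π
  have h3 := h1.unique (h2.congr_fun (fun j => by ring))
  rw [← h3]
  simp

theorem IsTeichmullerExpansion.unique {π x : 𝒪[K]} (hπ : Irreducible π) {a b : ℕ → 𝒪[K]}
    (ha : IsTeichmullerExpansion π x a) (hb : IsTeichmullerExpansion π x b) : a = b := by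
  funext n
  induction n generalizing x a b with
  | zero =>
    obtain ⟨y, -, hy⟩ := ha.exists_tail hπ
    obtain ⟨w, -, hw⟩ := hb.exists_tail hπ
    refine teichmuller_eq_of_norm_lt hπ (ha.1 0) (hb.1 0)
      ((dvd_iff_norm_lt_one hπ _).mpr ⟨w - y, ?_⟩)
    linear_combination hw - hy
  | succ n ih =>
    have h0 : a 0 = b 0 := by
      obtain ⟨y, -, hy⟩ := ha.exists_tail hπ
      obtain ⟨w, -, hw⟩ := hb.exists_tail hπ
      refine teichmuller_eq_of_norm_lt hπ (ha.1 0) (hb.1 0)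
        ((dvd_iff_norm_lt_one hπ _).mpr ⟨w - y, ?_⟩)
      linear_combination hw - hy
    obtain ⟨y, hy', hy⟩ := ha.exists_tail hπ
    obtain ⟨w, hw', hw⟩ := hb.exists_tail hπ
    have hyw : y = w := by
      refine mul_left_cancel₀ hπ.ne_zero ?_
      linear_combination hw - hy - h0
    subst hyw
    exact ih hy' hw'

/-- The Teichmüller digit functions: for a uniformizer `π`, the element `teichmullerDigit π hπ j x`
is the `j`-th digit `ω_j(x)` of the unique expansion `x = ∑ j, ω_j(x) * π ^ j` whose digits are
Teichmüller representatives. -/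
noncomputable def teichmullerDigit (π : 𝒪[K]) (hπ : Irreducible π) (j : ℕ) (x : 𝒪[K]) : 𝒪[K] :=
  (exists_isTeichmullerExpansion hπ x).choose j

theorem isTeichmullerExpansion_teichmullerDigit {π : 𝒪[K]} (hπ : Irreducible π) (x : 𝒪[K]) :
    IsTeichmullerExpansion π x (fun j => teichmullerDigit π hπ j x) :=
  (exists_isTeichmullerExpansion hπ x).choose_spec

theorem IsTeichmullerExpansion.eq_teichmullerDigit {π x : 𝒪[K]} (hπ : Irreducible π)
    {a : ℕ → 𝒪[K]} (h : IsTeichmullerExpansion π x a) (j : ℕ) : a j = teichmullerDigit π hπ j x :=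
  congrFun (h.unique hπ (isTeichmullerExpansion_teichmullerDigit hπ x)) j

end LocalField

section TateAlgebra

variable (K : Type*) [NontriviallyNormedField K] [IsUltrametricDist K]

/-- The infinite-dimensional Tate algebra `K⟨X_0, X_1, …⟩`: the formal power series
in the variables `X_0, X_1, …` whose coefficients tend to `0` along the cofinite filter on
the set of all monomials. -/
def TateAlgebra : Subalgebra K (MvPowerSeries ℕ K) where
  carrier := {f | Tendsto (fun i : ℕ →₀ ℕ => ‖MvPowerSeries.coeff i f‖) cofinite (𝓝 0)}
  mul_mem' {f g} hf hg := by
    have := MvPowerSeries.isRestricted.mul (1 : ℕ → ℝ) (f := f) (g := g)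
      (by simpa [MvPowerSeries.IsRestricted] using hf)
      (by simpa [MvPowerSeries.IsRestricted] using hg)
    simpa [MvPowerSeries.IsRestricted] using this
  add_mem' {f g} hf hg := by
    have := MvPowerSeries.isRestricted.add (1 : ℕ → ℝ) (f := f) (g := g)
      (by simpa [MvPowerSeries.IsRestricted] using hf)
      (by simpa [MvPowerSeries.IsRestricted] using hg)
    simpa [MvPowerSeries.IsRestricted] using this
  algebraMap_mem' c := by
    have := MvPowerSeries.isRestricted_C (1 : ℕ → ℝ) c
    rw [MvPowerSeries.c_eq_algebraMap] at this
    simpa [MvPowerSeries.IsRestricted] using this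

namespace TateAlgebra

variable {K}

/-- The variable `X_j` of the Tate algebra. -/
noncomputable def X (j : ℕ) : TateAlgebra K :=
  ⟨MvPowerSeries.X j, by
    have := MvPowerSeries.isRestricted_monomial (1 : ℕ → ℝ) (Finsupp.single j 1) (1 : K)
    simpa [MvPowerSeries.IsRestricted] using! this⟩

/-- The norm on the Tate algebra is the sup-norm on coefficients. -/
noncomputable instance : Norm (TateAlgebra K) where
  norm f := ⨆ i : ℕ →₀ ℕ, ‖MvPowerSeries.coeff i (f : MvPowerSeries ℕ K)‖

theorem norm_def (f : TateAlgebra K) :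
    ‖f‖ = ⨆ i : ℕ →₀ ℕ, ‖MvPowerSeries.coeff i (f : MvPowerSeries ℕ K)‖ := rfl

theorem bddAbove (f : TateAlgebra K) :
    BddAbove (Set.range fun i : ℕ →₀ ℕ => ‖MvPowerSeries.coeff i (f : MvPowerSeries ℕ K)‖) :=
  Tendsto.bddAbove_range_of_cofinite f.2

theorem norm_coeff_le (f : TateAlgebra K) (i : ℕ →₀ ℕ) :
    ‖MvPowerSeries.coeff i (f : MvPowerSeries ℕ K)‖ ≤ ‖f‖ :=
  le_ciSup (bddAbove f) i

theorem norm_le {f : TateAlgebra K} {r : ℝ}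
    (h : ∀ i, ‖MvPowerSeries.coeff i (f : MvPowerSeries ℕ K)‖ ≤ r) : ‖f‖ ≤ r :=
  ciSup_le h

theorem norm_nonneg' (f : TateAlgebra K) : 0 ≤ ‖f‖ :=
  (norm_nonneg _).trans (norm_coeff_le f 0)

/-- The additive group norm underlying the sup-norm on coefficients. -/
noncomputable def addGroupNorm : AddGroupNorm (TateAlgebra K) where
  toFun f := ‖f‖
  map_zero' := le_antisymm (norm_le fun i => by simp) (norm_nonneg' _)
  add_le' f g := norm_le fun i => by
    rw [Subalgebra.coe_add, map_add]
    exact (norm_add_le _ _).trans (add_le_add (norm_coeff_le f i) (norm_coeff_le g i))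
  neg' f := by simp [norm_def]
  eq_zero_of_map_eq_zero' f hf := by
    ext i
    have := norm_coeff_le f i
    rw [hf] at this
    simpa using this

theorem norm_mul_le' (f g : TateAlgebra K) : ‖f * g‖ ≤ ‖f‖ * ‖g‖ := norm_le fun i => by
  classical
  rw [Subalgebra.coe_mul, MvPowerSeries.coeff_mul]
  refine IsUltrametricDist.norm_sum_le_of_forall_le_of_nonneg
    (mul_nonneg (norm_nonneg' f) (norm_nonneg' g)) fun p _ => ?_
  rw [norm_mul]
  exact mul_le_mul (norm_coeff_le f _) (norm_coeff_le g _) (norm_nonneg _) (norm_nonneg' f)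

noncomputable instance : NormedCommRing (TateAlgebra K) where
  __ := addGroupNorm.toNormedAddCommGroup
  __ := (inferInstance : CommRing (TateAlgebra K))
  norm_mul_le := norm_mul_le'

noncomputable instance : NormedAlgebra K (TateAlgebra K) where
  __ := (inferInstance : Algebra K (TateAlgebra K))
  norm_smul_le c f := norm_le fun i => by
    rw [Subalgebra.coe_smul, MvPowerSeries.coeff_smul, norm_mul]
    exact mul_le_mul_of_nonneg_left (norm_coeff_le f i) (norm_nonneg c)

variable (K)

/-- The ideal `I_q(K)`: the closure of the ideal generated by all `X_j ^ q - X_j`. -/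
noncomputable def frobeniusIdeal (q : ℕ) : Ideal (TateAlgebra K) :=
  (Ideal.span (Set.range fun j : ℕ => (X j : TateAlgebra K) ^ q - X j)).closure

instance (q : ℕ) : IsClosed (frobeniusIdeal K q : Set (TateAlgebra K)) :=
  isClosed_closure

end TateAlgebra

end TateAlgebra

/-! The map `Ψ_π` is evaluation of power series at the Teichmüller digits. Each digit `ω_j` is a
locally constant function on `𝒪[K]` of norm at most `1`, so `f ↦ ∑ i, a_i ω^i` converges in the
complete ultrametric algebra `C(𝒪[K], K)` and does not increase norms (`TateAlgebra.evalHom`,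
`digitEval`). As `ω_j ^ q = ω_j`, it factors through the quotient by the Frobenius ideal
(`quotientDigitEval`).

The quotient map is isometric. By density of the polynomials it suffices to see that the residue
norm of a polynomial is at most the norm of its value (`norm_mk_aeval_X_le`). Reducing all exponents
below `q` by means of `X_j ^ q = X_j` changes neither the class in the quotient nor the value in
`C(𝒪[K], K)` (`aeval_reducedPolynomial`), and the norm of a reduced polynomial is at most the norm
of its value (`norm_coeff_le_norm_aeval_digitMap`): after scaling, its reduction is a nonzero
polynomial over the residue field with all exponents less than `q`, so it does not vanish
identically, while the residues of the digits can be prescribed arbitrarily.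

The Tate algebra is complete, being isometric to a space of functions vanishing at infinity, hence
so is the quotient, and the image of the isometry is closed. It is dense because a continuous
function on `𝒪[K]` is uniformly close to a function of finitely many digits, which is a polynomial
in these digits by Lagrange interpolation (`denseRange_digitEval`). Thus the map is bijective.
Finally `Ψ_π` determines the digit functions, and these determine `π`, whose own digits are
`0, 1, 0, 0, …` (`eq_of_teichmullerDigit_eq`). -/

/-! ### The Tate algebra: completeness, density of polynomials, evaluation -/

namespace TateAlgebra

variable {K : Type*} [NontriviallyNormedField K] [IsUltrametricDist K]

section Complete

/-- The exponents of monomials, as a type of its own so that it can carry the discrete topology. -/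
def Exponent : Type := ℕ →₀ ℕ

instance : TopologicalSpace Exponent := ⊥

instance : DiscreteTopology Exponent := ⟨rfl⟩

/-- The Tate algebra as the space of null families of coefficients. -/
noncomputable def toZeroAtInfty : TateAlgebra K ≃ ZeroAtInftyContinuousMap Exponent K where
  toFun f := ⟨⟨fun i => MvPowerSeries.coeff i (f : MvPowerSeries ℕ K),
    continuous_of_discreteTopology⟩, by
      rw [cocompact_eq_cofinite]
      exact tendsto_zero_iff_norm_tendsto_zero.mpr f.2⟩
  invFun g := ⟨fun i => g i, by
    have := g.zero_at_infty'
    rw [cocompact_eq_cofinite] at this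
    exact tendsto_zero_iff_norm_tendsto_zero.mp this⟩
  left_inv f := rfl
  right_inv g := rfl

theorem isometry_toZeroAtInfty : Isometry (toZeroAtInfty (K := K)) := by
  refine Isometry.of_dist_eq fun f g => ?_
  have : Nonempty Exponent := ⟨(0 : ℕ →₀ ℕ)⟩
  rw [← ZeroAtInftyContinuousMap.dist_toBCF_eq_dist, BoundedContinuousFunction.dist_eq_iSup]
  refine Eq.trans ?_ ((dist_eq_norm f g).trans (norm_def (f - g))).symm
  refine iSup_congr fun i => ?_
  rw [dist_eq_norm, Subalgebra.coe_sub, map_sub]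
  rfl

instance [CompleteSpace K] : CompleteSpace (TateAlgebra K) :=
  (IsometryEquiv.mk toZeroAtInfty isometry_toZeroAtInfty).completeSpace

end Complete

section Polynomial

theorem coe_aeval_X (p : MvPolynomial ℕ K) :
    ((MvPolynomial.aeval (X : ℕ → TateAlgebra K) p : TateAlgebra K) : MvPowerSeries ℕ K) = p := by
  have : (TateAlgebra K).val.comp (MvPolynomial.aeval (X : ℕ → TateAlgebra K)) =
      MvPolynomial.coeToMvPowerSeries.algHom K := by
    ext j : 1
    simp [X]
  simpa using DFunLike.congr_fun this p

theorem coeff_aeval_X (p : MvPolynomial ℕ K) (i : ℕ →₀ ℕ) :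
    MvPowerSeries.coeff i
      ((MvPolynomial.aeval (X : ℕ → TateAlgebra K) p : TateAlgebra K) : MvPowerSeries ℕ K) =
      p.coeff i := by
  rw [coe_aeval_X, MvPolynomial.coeff_coe]

theorem denseRange_aeval_X :
    DenseRange (MvPolynomial.aeval (X : ℕ → TateAlgebra K) : MvPolynomial ℕ K → TateAlgebra K) := by
  refine Metric.denseRange_iff.mpr fun f ε hε => ?_
  have hfin : {i : ℕ →₀ ℕ | ¬ ‖MvPowerSeries.coeff i (f : MvPowerSeries ℕ K)‖ < ε / 2}.Finite :=
    (Tendsto.eventually_lt_const (half_pos hε) f.2)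
  classical
  refine ⟨∑ i ∈ hfin.toFinset, MvPolynomial.monomial i
    (MvPowerSeries.coeff i (f : MvPowerSeries ℕ K)), ?_⟩
  rw [dist_eq_norm]
  refine (norm_le fun i => ?_).trans_lt (half_lt_self hε)
  rw [Subalgebra.coe_sub, map_sub, coeff_aeval_X, MvPolynomial.coeff_sum]
  simp only [MvPolynomial.coeff_monomial, Finset.sum_ite_eq', Set.Finite.mem_toFinset,
    Set.mem_ofPred_eq]
  split_ifs with h
  · rw [sub_zero]
    exact h.le
  · rw [sub_self, norm_zero]
    exact (half_pos hε).le

end Polynomial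

section Evaluation

variable {A : Type*} [NormedCommRing A]

/-- The value of the monomial with exponent `i` at the family `w`. -/
noncomputable def monomialValue (w : ℕ → A) (i : ℕ →₀ ℕ) : A := i.prod fun j n => w j ^ n

theorem monomialValue_add (w : ℕ → A) (i j : ℕ →₀ ℕ) :
    monomialValue w (i + j) = monomialValue w i * monomialValue w j :=
  Finsupp.prod_add_index' (fun _ => pow_zero _) (fun _ => pow_add _)

variable [NormedAlgebra K A]

theorem tsum_coeff_one (w : ℕ → A) :
    ∑' i, MvPowerSeries.coeff i ((1 : TateAlgebra K) : MvPowerSeries ℕ K) •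
      monomialValue w i = 1 := by
  classical
  rw [tsum_eq_single 0]
  · simp [monomialValue]
  · intro i hi
    simp [MvPowerSeries.coeff_one, hi]

variable [NormOneClass A]

theorem norm_monomialValue_le {w : ℕ → A} (hw : ∀ j, ‖w j‖ ≤ 1) (i : ℕ →₀ ℕ) :
    ‖monomialValue w i‖ ≤ 1 :=
  (Finset.norm_prod_le _ _).trans <| Finset.prod_le_one (fun _ _ => norm_nonneg _) fun j _ =>
    (norm_pow_le _ _).trans (pow_le_one₀ (norm_nonneg _) (hw j))

theorem norm_coeff_smul_monomialValue_le {w : ℕ → A} (hw : ∀ j, ‖w j‖ ≤ 1) (f : TateAlgebra K)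
    (i : ℕ →₀ ℕ) :
    ‖MvPowerSeries.coeff i (f : MvPowerSeries ℕ K) • monomialValue w i‖ ≤
      ‖MvPowerSeries.coeff i (f : MvPowerSeries ℕ K)‖ :=
  (norm_smul_le _ _).trans
    (mul_le_of_le_one_right (norm_nonneg _) (norm_monomialValue_le hw i))

variable [IsUltrametricDist A] [CompleteSpace A]

theorem summable_coeff_smul_monomialValue {w : ℕ → A} (hw : ∀ j, ‖w j‖ ≤ 1) (f : TateAlgebra K) :
    Summable fun i => MvPowerSeries.coeff i (f : MvPowerSeries ℕ K) • monomialValue w i :=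
  NonarchimedeanAddGroup.summable_of_tendsto_cofinite_zero <|
    squeeze_zero_norm (norm_coeff_smul_monomialValue_le hw f) f.2

theorem tsum_coeff_mul {w : ℕ → A} (hw : ∀ j, ‖w j‖ ≤ 1) (f g : TateAlgebra K) :
    ∑' i, MvPowerSeries.coeff i ((f * g : TateAlgebra K) : MvPowerSeries ℕ K) •
        monomialValue w i =
      (∑' i, MvPowerSeries.coeff i (f : MvPowerSeries ℕ K) • monomialValue w i) *
        ∑' i, MvPowerSeries.coeff i (g : MvPowerSeries ℕ K) • monomialValue w i := by
  classical
  have : NonarchimedeanRing A := ⟨NonarchimedeanAddGroup.is_nonarchimedean⟩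
  have hf := summable_coeff_smul_monomialValue hw f
  have hg := summable_coeff_smul_monomialValue hw g
  have hfg := hf.mul_of_nonarchimedean hg
  refine Eq.trans ?_ (hf.tsum_mul_tsum_eq_tsum_sum_antidiagonal hg hfg).symm
  refine tsum_congr fun i => ?_
  rw [Subalgebra.coe_mul, MvPowerSeries.coeff_mul, Finset.sum_smul]
  refine Finset.sum_congr rfl fun p hp => ?_
  rw [smul_mul_smul_comm, ← monomialValue_add, Finset.HasAntidiagonal.mem_antidiagonal.mp hp]

/-- Evaluation of elements of the Tate algebra at a family of elements of the closed unit ball of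
a complete ultrametric algebra. -/
noncomputable def evalHom (w : ℕ → A) (hw : ∀ j, ‖w j‖ ≤ 1) : TateAlgebra K →ₐ[K] A :=
  AlgHom.ofLinearMap
    { toFun := fun f =>
        ∑' i, MvPowerSeries.coeff i (f : MvPowerSeries ℕ K) • monomialValue w i
      map_add' := fun f g => by
        rw [← (summable_coeff_smul_monomialValue hw f).tsum_add
          (summable_coeff_smul_monomialValue hw g)]
        exact tsum_congr fun i => by rw [Subalgebra.coe_add, map_add, add_smul]
      map_smul' := fun c f => by
        rw [RingHom.id_apply, ← (summable_coeff_smul_monomialValue hw f).tsum_const_smul]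
        exact tsum_congr fun i => by
          rw [Subalgebra.coe_smul, MvPowerSeries.coeff_smul, mul_smul] }
    (tsum_coeff_one w) (tsum_coeff_mul hw)

theorem evalHom_apply (w : ℕ → A) (hw : ∀ j, ‖w j‖ ≤ 1) (f : TateAlgebra K) :
    evalHom w hw f =
      ∑' i, MvPowerSeries.coeff i (f : MvPowerSeries ℕ K) • monomialValue w i := rfl

theorem evalHom_X (w : ℕ → A) (hw : ∀ j, ‖w j‖ ≤ 1) (j : ℕ) :
    evalHom w hw (X j : TateAlgebra K) = w j := by
  classical
  rw [evalHom_apply, tsum_eq_single (Finsupp.single j 1)]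
  · simp [monomialValue, X]
  · intro i hi
    simp [X, MvPowerSeries.coeff_X, hi]

theorem norm_evalHom_le (w : ℕ → A) (hw : ∀ j, ‖w j‖ ≤ 1) (f : TateAlgebra K) :
    ‖evalHom w hw f‖ ≤ ‖f‖ := by
  refine le_of_tendsto (summable_coeff_smul_monomialValue hw f).hasSum.norm
    (Eventually.of_forall fun s => ?_)
  exact IsUltrametricDist.norm_sum_le_of_forall_le_of_nonneg (norm_nonneg f) fun i _ =>
    (norm_coeff_smul_monomialValue_le hw f i).trans (norm_coeff_le f i)

theorem continuous_evalHom (w : ℕ → A) (hw : ∀ j, ‖w j‖ ≤ 1) :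
    Continuous (evalHom w hw : TateAlgebra K → A) :=
  AddMonoidHomClass.continuous_of_bound (evalHom w hw) 1 fun f => by
    rw [one_mul]
    exact norm_evalHom_le w hw f

end Evaluation

theorem mk_X_pow (q j : ℕ) :
    Ideal.Quotient.mk (frobeniusIdeal K q) (X j) ^ q = Ideal.Quotient.mk _ (X j) := by
  rw [← map_pow, Ideal.Quotient.eq]
  exact subset_closure (Ideal.subset_span ⟨j, rfl⟩)

end TateAlgebra

/-! ### Polynomials with exponents less than `q` -/

section ReducedPolynomial

/-- The exponent in `[1, q - 1]` congruent to `n` modulo `q - 1`, and `0` for `n = 0`: it satisfies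
`z ^ reducedExponent q n = z ^ n` whenever `z ^ q = z`. -/
def reducedExponent (q n : ℕ) : ℕ := if n = 0 then 0 else (n - 1) % (q - 1) + 1

theorem reducedExponent_zero (q : ℕ) : reducedExponent q 0 = 0 := if_pos rfl

theorem reducedExponent_lt {q : ℕ} (hq : 1 < q) (n : ℕ) : reducedExponent q n < q := by
  have := Nat.mod_lt (n - 1) (Nat.sub_pos_of_lt hq)
  unfold reducedExponent
  split_ifs <;> omega

theorem pow_reducedExponent {M : Type*} [CommMonoid M] {q : ℕ} (hq : 1 < q) {z : M}
    (hz : z ^ q = z) (n : ℕ) : z ^ reducedExponent q n = z ^ n := by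
  -- multiplying by `z ^ (q - 1)` does not change positive powers of `z`
  have key : ∀ k s, z ^ ((q - 1) * k + s + 1) = z ^ (s + 1) := by
    intro k s
    induction k with
    | zero => simp
    | succ k ih =>
      have : (q - 1) * (k + 1) + s + 1 = q + ((q - 1) * k + s) := by
        rw [mul_add]; omega
      rw [this, pow_add, hz, ← pow_succ', ih]
  unfold reducedExponent
  split_ifs with h
  · rw [h]
  · rw [← key ((n - 1) / (q - 1)), Nat.div_add_mod, Nat.sub_add_cancel (Nat.pos_of_ne_zero h)]

variable {R : Type*} [CommRing R]

/-- The polynomial obtained by reducing all exponents below `q` using the relations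
`X_j ^ q = X_j`. -/
noncomputable def reducedPolynomial (q : ℕ) (P : MvPolynomial ℕ R) : MvPolynomial ℕ R :=
  ∑ i ∈ P.support,
    MvPolynomial.monomial (i.mapRange (reducedExponent q) (reducedExponent_zero q)) (P.coeff i)

theorem lt_of_mem_support_reducedPolynomial {q : ℕ} (hq : 1 < q) (P : MvPolynomial ℕ R)
    {i : ℕ →₀ ℕ} (hi : i ∈ (reducedPolynomial q P).support) (j : ℕ) : i j < q := by
  classical
  obtain ⟨k, -, hk⟩ := Finset.mem_biUnion.mp (MvPolynomial.support_sum hi)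
  rw [Finset.mem_singleton.mp (MvPolynomial.support_monomial_subset hk), Finsupp.mapRange_apply]
  exact reducedExponent_lt hq _

theorem aeval_reducedPolynomial {A : Type*} [CommRing A] [Algebra R A] {q : ℕ} (hq : 1 < q)
    {w : ℕ → A} (hw : ∀ j, w j ^ q = w j) (P : MvPolynomial ℕ R) :
    MvPolynomial.aeval w (reducedPolynomial q P) = MvPolynomial.aeval w P := by
  conv_rhs => rw [P.as_sum]
  rw [reducedPolynomial, map_sum, map_sum]
  refine Finset.sum_congr rfl fun i _ => ?_
  rw [MvPolynomial.aeval_monomial, MvPolynomial.aeval_monomial,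
    Finsupp.prod_mapRange_index fun _ => pow_zero _]
  simp only [pow_reducedExponent hq (hw _)]

/-- A nonzero polynomial over a finite field `k` all of whose exponents are less than the size of
`k` has a nonzero value, also when there are infinitely many variables. -/
theorem exists_eval_ne_zero_of_exponents_lt {σ k : Type*} [Field k] [Finite k]
    {p : MvPolynomial σ k} (hp : p ≠ 0) (hdeg : ∀ i ∈ p.support, ∀ j, i j < Nat.card k) :
    ∃ v : σ → k, MvPolynomial.eval v p ≠ 0 := by
  classical
  have := Fintype.ofFinite k
  obtain ⟨s, p', rfl⟩ := MvPolynomial.exists_finset_rename p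
  have hp' : p' ≠ 0 := by rintro rfl; exact hp (map_zero _)
  by_contra! h
  refine hp' (MvPolynomial.eq_zero_of_eval_zero_at_prod_finset p' (fun _ => Finset.univ)
    (fun j => ?_) fun x _ => ?_)
  · rw [← MvPolynomial.degreeOf_rename_of_injective Subtype.val_injective, Finset.card_univ,
      ← Nat.card_eq_fintype_card, MvPolynomial.degreeOf_lt_iff Nat.card_pos]
    exact fun i hi => hdeg i hi _
  · have := h (Function.extend Subtype.val x 0)
    rwa [MvPolynomial.eval_rename, Function.extend_comp Subtype.val_injective] at this

end ReducedPolynomial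

/-! ### Teichmüller digits as continuous functions -/

section Digits

variable {K : Type*} [NontriviallyNormedField K] [IsUltrametricDist K] [LocallyCompactSpace K]

theorem IsTeichmullerExpansion.zero_eq_of_norm_sub_lt_one {π : 𝒪[K]} (hπ : Irreducible π)
    {x y : 𝒪[K]} {a b : ℕ → 𝒪[K]} (ha : IsTeichmullerExpansion π x a)
    (hb : IsTeichmullerExpansion π y b) (h : ‖x - y‖ < 1) : a 0 = b 0 := by
  have hπ1 := Valued.integer.norm_irreducible_lt_one hπ
  have hπ0 : IsLocalRing.residue 𝒪[K] π = 0 := by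
    rwa [← map_zero (IsLocalRing.residue 𝒪[K]), residue_eq_iff_norm, sub_zero]
  rw [← residue_eq_iff_norm] at h
  obtain ⟨x', -, rfl⟩ := ha.exists_tail hπ
  obtain ⟨y', -, rfl⟩ := hb.exists_tail hπ
  refine teichmuller_eq_of_norm_lt hπ (ha.1 0) (hb.1 0) ((residue_eq_iff_norm _ _).mp ?_)
  simpa [hπ0] using h

/-- The `n`-th digit of `x` depends only on the class of `x` modulo `π ^ (n + 1)`, that is, only on
the open ball of radius `‖π‖ ^ n` around `x`. -/
theorem IsTeichmullerExpansion.eq_of_norm_sub_lt {π : 𝒪[K]} (hπ : Irreducible π) (n : ℕ)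
    {x y : 𝒪[K]} {a b : ℕ → 𝒪[K]} (ha : IsTeichmullerExpansion π x a)
    (hb : IsTeichmullerExpansion π y b) (h : ‖x - y‖ < ‖π‖ ^ n) : a n = b n := by
  induction n generalizing x y a b with
  | zero => exact ha.zero_eq_of_norm_sub_lt_one hπ hb (by rwa [pow_zero] at h)
  | succ n ih =>
    have h0 : a 0 = b 0 := ha.zero_eq_of_norm_sub_lt_one hπ hb <| h.trans_le <|
      pow_le_one₀ (norm_nonneg _) (Valued.integer.norm_irreducible_lt_one hπ).le
    obtain ⟨x', hx', rfl⟩ := ha.exists_tail hπ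
    obtain ⟨y', hy', rfl⟩ := hb.exists_tail hπ
    refine ih hx' hy' ?_
    rw [h0, add_sub_add_left_eq_sub, ← mul_sub, norm_mul, pow_succ'] at h
    exact lt_of_mul_lt_mul_left h (norm_nonneg _)

theorem continuous_teichmullerDigit {π : 𝒪[K]} (hπ : Irreducible π) (j : ℕ) :
    Continuous (teichmullerDigit π hπ j) := by
  refine (IsLocallyConstant.iff_eventually_eq _).mpr (fun x => ?_) |>.continuous
  have hpos : 0 < ‖π‖ ^ j := pow_pos (norm_pos_iff.mpr hπ.ne_zero) j
  filter_upwards [Metric.ball_mem_nhds x hpos] with y hy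
  rw [Metric.mem_ball, dist_eq_norm] at hy
  exact (isTeichmullerExpansion_teichmullerDigit hπ y).eq_of_norm_sub_lt hπ j
    (isTeichmullerExpansion_teichmullerDigit hπ x) hy

theorem IsTeichmullerExpansion.exists_eq_sum_range_add {π x : 𝒪[K]} (hπ : Irreducible π)
    {a : ℕ → 𝒪[K]} (h : IsTeichmullerExpansion π x a) (n : ℕ) :
    ∃ y, x = ∑ j ∈ Finset.range n, a j * π ^ j + π ^ n * y := by
  induction n generalizing x a with
  | zero => exact ⟨x, by simp⟩
  | succ n ih =>
    obtain ⟨x', hx', rfl⟩ := h.exists_tail hπ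
    obtain ⟨y, rfl⟩ := ih hx'
    refine ⟨y, ?_⟩
    rw [Finset.sum_range_succ', mul_add, Finset.mul_sum]
    have : ∀ j, π * (a (j + 1) * π ^ j) = a (j + 1) * π ^ (j + 1) := fun j => by ring
    simp only [this]
    ring

/-- The Teichmüller digits can have arbitrarily prescribed residues. -/
theorem exists_residue_teichmullerDigit_eq {π : 𝒪[K]} (hπ : Irreducible π) (v : ℕ → 𝓀[K]) :
    ∃ x, ∀ j, IsLocalRing.residue 𝒪[K] (teichmullerDigit π hπ j x) = v j := by
  choose u hu using fun j => IsLocalRing.residue_surjective (v j)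
  choose z y hz hy using fun j => exists_teichmuller_add_mul hπ (u j)
  obtain ⟨x, hx⟩ := summable_mul_pow hπ z
  have hexp : IsTeichmullerExpansion π x z := ⟨hz, hx⟩
  refine ⟨x, fun j => ?_⟩
  rw [← hexp.eq_teichmullerDigit hπ, ← hu j, residue_eq_iff_norm, dvd_iff_norm_lt_one hπ]
  exact ⟨-y j, by linear_combination -hy j⟩

theorem one_lt_card_residueField : 1 < Nat.card 𝓀[K] :=
  have := (localField_dvr_and_finite (K := K)).2
  Finite.one_lt_card

/-- The Teichmüller digit `ω_j` as an element of `C(𝒪[K], K)`. -/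
noncomputable def digitMap (π : 𝒪[K]) (hπ : Irreducible π) (j : ℕ) : C(𝒪[K], K) :=
  ⟨fun x => teichmullerDigit π hπ j x,
    continuous_subtype_val.comp (continuous_teichmullerDigit hπ j)⟩

theorem digitMap_apply {π : 𝒪[K]} (hπ : Irreducible π) (j : ℕ) (x : 𝒪[K]) :
    digitMap π hπ j x = (teichmullerDigit π hπ j x : K) := rfl

theorem norm_digitMap_le_one {π : 𝒪[K]} (hπ : Irreducible π) (j : ℕ) : ‖digitMap π hπ j‖ ≤ 1 :=
  (ContinuousMap.norm_le _ zero_le_one).mpr fun _ => Valued.integer.norm_le_one _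

theorem digitMap_pow_card {π : 𝒪[K]} (hπ : Irreducible π) (j : ℕ) :
    digitMap π hπ j ^ Nat.card 𝓀[K] = digitMap π hπ j := by
  ext x
  exact congrArg Subtype.val ((isTeichmullerExpansion_teichmullerDigit hπ x).1 j)

/-- The reduced monomials in the digits are orthonormal: modulo the maximal ideal a reduced
polynomial of norm one becomes a nonzero reduced polynomial over the residue field, which has a
nonzero value, and the digits take arbitrary residues. -/
theorem norm_coeff_le_norm_aeval_digitMap {π : 𝒪[K]} (hπ : Irreducible π) {P : MvPolynomial ℕ K}
    (hP : ∀ i ∈ P.support, ∀ j, i j < Nat.card 𝓀[K]) (i : ℕ →₀ ℕ) :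
    ‖P.coeff i‖ ≤ ‖MvPolynomial.aeval (digitMap π hπ) P‖ := by
  have := (localField_dvr_and_finite (K := K)).2
  by_cases hi : P.coeff i = 0
  · rw [hi, norm_zero]; exact norm_nonneg _
  obtain ⟨m, hm, hmax⟩ := P.support.exists_max_image (fun i => ‖P.coeff i‖)
    ⟨i, MvPolynomial.mem_support_iff.mpr hi⟩
  refine (hmax i (MvPolynomial.mem_support_iff.mpr hi)).trans ?_
  set c := P.coeff m with hc
  have hc0 : c ≠ 0 := MvPolynomial.mem_support_iff.mp hm
  have hle : ∀ k, ‖c⁻¹ * P.coeff k‖ ≤ 1 := by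
    intro k
    rw [norm_mul, norm_inv, inv_mul_le_one₀ (norm_pos_iff.mpr hc0)]
    by_cases hk : P.coeff k = 0
    · rw [hk, norm_zero]; exact norm_nonneg _
    · exact hmax k (MvPolynomial.mem_support_iff.mpr hk)
  -- the polynomial `c⁻¹ P` has integral coefficients, one of which is `1`
  obtain ⟨Q, hQ⟩ : ∃ Q : MvPolynomial ℕ 𝒪[K],
      MvPolynomial.map (algebraMap 𝒪[K] K) Q = MvPolynomial.C c⁻¹ * P := by
    refine MvPolynomial.mem_range_map_iff_coeffs_subset.mpr ?_
    intro a ha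
    obtain ⟨k, -, rfl⟩ := MvPolynomial.mem_coeffs_iff.mp ha
    rw [MvPolynomial.coeff_C_mul]
    exact ⟨⟨_, Valued.integer.mem_iff.mpr (hle k)⟩, rfl⟩
  have hQc : ∀ k, ((Q.coeff k : 𝒪[K]) : K) = c⁻¹ * P.coeff k := fun k => by
    rw [← MvPolynomial.coeff_C_mul, ← hQ, MvPolynomial.coeff_map]; rfl
  obtain ⟨v, hv⟩ := exists_eval_ne_zero_of_exponents_lt
    (p := MvPolynomial.map (IsLocalRing.residue 𝒪[K]) Q)
    (fun h0 => by
      have h1 := congrArg (MvPolynomial.coeff m) h0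
      have h2 : Q.coeff m = 1 := Subtype.ext (by rw [hQc, ← hc, inv_mul_cancel₀ hc0]; rfl)
      rw [MvPolynomial.coeff_map, h2, map_one, MvPolynomial.coeff_zero] at h1
      exact one_ne_zero h1)
    (fun k hk => hP k (by
      rw [MvPolynomial.mem_support_iff, MvPolynomial.coeff_map] at hk
      rw [MvPolynomial.mem_support_iff]
      intro h0
      refine hk ?_
      rw [show Q.coeff k = 0 from Subtype.ext (by rw [hQc, h0, mul_zero]; rfl), map_zero]))
  obtain ⟨x, hx⟩ := exists_residue_teichmullerDigit_eq hπ v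
  set d : ℕ → 𝒪[K] := fun j => teichmullerDigit π hπ j x with hd
  -- the residue of this value is the nonzero value at `v` of the reduction of `Q`
  have hunit : ‖MvPolynomial.eval d Q‖ = 1 := by
    refine le_antisymm (Valued.integer.norm_le_one _) (not_lt.mp fun hlt => hv ?_)
    rw [← sub_zero (MvPolynomial.eval d Q), ← residue_eq_iff_norm, map_zero] at hlt
    rw [← hlt, MvPolynomial.eval_map, show v = IsLocalRing.residue 𝒪[K] ∘ d from
      funext fun j => (hx j).symm, MvPolynomial.eval₂_comp]
  have hval : ((MvPolynomial.eval d Q : 𝒪[K]) : K) =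
      c⁻¹ * MvPolynomial.aeval (digitMap π hπ) P x := by
    have h1 : algebraMap 𝒪[K] K (MvPolynomial.eval d Q) =
        MvPolynomial.eval (algebraMap 𝒪[K] K ∘ d) (MvPolynomial.C c⁻¹ * P) := by
      rw [← hQ, MvPolynomial.eval_map, MvPolynomial.eval₂_comp]
    have h2 : MvPolynomial.aeval (digitMap π hπ) P x =
        MvPolynomial.eval (algebraMap 𝒪[K] K ∘ d) P :=
      DFunLike.congr_fun (MvPolynomial.comp_aeval (digitMap π hπ)
        (ContinuousMap.evalAlgHom K K x)) P
    rw [h2, ← MvPolynomial.eval_C (f := algebraMap 𝒪[K] K ∘ d) c⁻¹, ← map_mul]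
    exact h1
  have h1 : ‖c⁻¹ * MvPolynomial.aeval (digitMap π hπ) P x‖ = 1 := by rw [← hval]; exact hunit
  rw [norm_mul, norm_inv, inv_mul_eq_one₀ (norm_ne_zero_iff.mpr hc0)] at h1
  rw [h1]
  exact ContinuousMap.norm_coe_le_norm _ x

end Digits

/-! ### Evaluation at the digits is isometric on the quotient -/

section Isometry

variable {K : Type*} [NontriviallyNormedField K] [IsUltrametricDist K] [LocallyCompactSpace K]

theorem completeSpace_of_locallyCompactSpace : CompleteSpace K :=
  have : ProperSpace K := .of_nontriviallyNormedField_of_weaklyLocallyCompactSpace K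
  inferInstance

/-- Evaluation of elements of the Tate algebra at the Teichmüller digits. -/
noncomputable def digitEval (π : 𝒪[K]) (hπ : Irreducible π) : TateAlgebra K →ₐ[K] C(𝒪[K], K) :=
  have : CompleteSpace K := completeSpace_of_locallyCompactSpace
  TateAlgebra.evalHom (digitMap π hπ) (norm_digitMap_le_one hπ)

theorem digitEval_X {π : 𝒪[K]} (hπ : Irreducible π) (j : ℕ) :
    digitEval π hπ (TateAlgebra.X j) = digitMap π hπ j :=
  have : CompleteSpace K := completeSpace_of_locallyCompactSpace
  TateAlgebra.evalHom_X _ (norm_digitMap_le_one hπ) j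

theorem continuous_digitEval {π : 𝒪[K]} (hπ : Irreducible π) : Continuous (digitEval π hπ) :=
  have : CompleteSpace K := completeSpace_of_locallyCompactSpace
  TateAlgebra.continuous_evalHom _ (norm_digitMap_le_one hπ)

theorem norm_digitEval_le {π : 𝒪[K]} (hπ : Irreducible π) (f : TateAlgebra K) :
    ‖digitEval π hπ f‖ ≤ ‖f‖ :=
  have : CompleteSpace K := completeSpace_of_locallyCompactSpace
  TateAlgebra.norm_evalHom_le _ (norm_digitMap_le_one hπ) f

theorem digitEval_aeval_X {π : 𝒪[K]} (hπ : Irreducible π) (P : MvPolynomial ℕ K) :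
    digitEval π hπ (MvPolynomial.aeval TateAlgebra.X P) =
      MvPolynomial.aeval (digitMap π hπ) P := by
  refine (DFunLike.congr_fun (MvPolynomial.comp_aeval TateAlgebra.X (digitEval π hπ)) P).trans ?_
  simp only [digitEval_X]

theorem digitEval_eq_zero {π : 𝒪[K]} (hπ : Irreducible π) {f : TateAlgebra K}
    (hf : f ∈ TateAlgebra.frobeniusIdeal K (Nat.card 𝓀[K])) : digitEval π hπ f = 0 := by
  have hclosed : IsClosed {f : TateAlgebra K | digitEval π hπ f = 0} :=
    isClosed_eq (continuous_digitEval hπ) continuous_const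
  refine closure_minimal ?_ hclosed hf
  change _ ⊆ (RingHom.ker (digitEval π hπ) : Set (TateAlgebra K))
  refine SetLike.coe_subset_coe.mpr (Ideal.span_le.mpr ?_)
  rintro _ ⟨j, rfl⟩
  rw [SetLike.mem_coe, RingHom.mem_ker, map_sub, map_pow, digitEval_X, digitMap_pow_card, sub_self]

/-- The homomorphism induced by `digitEval` on the quotient by the Frobenius ideal. -/
noncomputable def quotientDigitEval (π : 𝒪[K]) (hπ : Irreducible π) :
    (TateAlgebra K ⧸ TateAlgebra.frobeniusIdeal K (Nat.card 𝓀[K])) →ₐ[K] C(𝒪[K], K) :=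
  Ideal.Quotient.liftₐ _ (digitEval π hπ) fun _ => digitEval_eq_zero hπ

theorem quotientDigitEval_mk {π : 𝒪[K]} (hπ : Irreducible π) (f : TateAlgebra K) :
    quotientDigitEval π hπ (Ideal.Quotient.mk _ f) = digitEval π hπ f := rfl

theorem norm_digitEval_le_norm_mk {π : 𝒪[K]} (hπ : Irreducible π) (f : TateAlgebra K) :
    ‖digitEval π hπ f‖ ≤
      ‖Ideal.Quotient.mk (TateAlgebra.frobeniusIdeal K (Nat.card 𝓀[K])) f‖ := by
  refine le_of_forall_pos_le_add fun ε hε => ?_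
  obtain ⟨g, hg, hlt⟩ := Ideal.Quotient.norm_mk_lt
    (Ideal.Quotient.mk (TateAlgebra.frobeniusIdeal K (Nat.card 𝓀[K])) f) hε
  rw [← quotientDigitEval_mk, ← hg, quotientDigitEval_mk]
  exact (norm_digitEval_le hπ g).trans (hg ▸ hlt.le)

/-- The residue norm of a polynomial is at most the norm of its value at the digits, as one sees
on the reduced polynomial in the same class. -/
theorem norm_mk_aeval_X_le {π : 𝒪[K]} (hπ : Irreducible π) (P : MvPolynomial ℕ K) :
    ‖Ideal.Quotient.mk (TateAlgebra.frobeniusIdeal K (Nat.card 𝓀[K]))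
      (MvPolynomial.aeval TateAlgebra.X P)‖ ≤
      ‖digitEval π hπ (MvPolynomial.aeval TateAlgebra.X P)‖ := by
  have hq : 1 < Nat.card 𝓀[K] := one_lt_card_residueField
  have hmk : ∀ Q : MvPolynomial ℕ K,
      Ideal.Quotient.mk (TateAlgebra.frobeniusIdeal K (Nat.card 𝓀[K]))
        (MvPolynomial.aeval TateAlgebra.X Q) =
      MvPolynomial.aeval (fun j => Ideal.Quotient.mk
        (TateAlgebra.frobeniusIdeal K (Nat.card 𝓀[K])) (TateAlgebra.X j)) Q := fun Q =>
    DFunLike.congr_fun (MvPolynomial.comp_aeval TateAlgebra.X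
      (Ideal.Quotient.mkₐ K (TateAlgebra.frobeniusIdeal K (Nat.card 𝓀[K])))) Q
  rw [hmk, ← aeval_reducedPolynomial hq (TateAlgebra.mk_X_pow (K := K) _) P, ← hmk,
    digitEval_aeval_X, ← aeval_reducedPolynomial hq (digitMap_pow_card hπ) P]
  refine (Ideal.Quotient.norm_mk_le _ _).trans (TateAlgebra.norm_le fun i => ?_)
  rw [TateAlgebra.coeff_aeval_X]
  exact norm_coeff_le_norm_aeval_digitMap hπ
    (fun i hi => lt_of_mem_support_reducedPolynomial hq P hi) i

theorem norm_quotientDigitEval {π : 𝒪[K]} (hπ : Irreducible π)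
    (f : TateAlgebra K ⧸ TateAlgebra.frobeniusIdeal K (Nat.card 𝓀[K])) :
    ‖quotientDigitEval π hπ f‖ = ‖f‖ := by
  obtain ⟨f, rfl⟩ := Ideal.Quotient.mk_surjective f
  rw [quotientDigitEval_mk]
  refine le_antisymm (norm_digitEval_le_norm_mk hπ f) ?_
  have hmk : Continuous (Ideal.Quotient.mk (TateAlgebra.frobeniusIdeal K (Nat.card 𝓀[K]))) :=
    continuous_quot_mk
  exact isClosed_property TateAlgebra.denseRange_aeval_X
    (isClosed_le hmk.norm (continuous_digitEval hπ).norm) (norm_mk_aeval_X_le hπ) f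

theorem isometry_quotientDigitEval {π : 𝒪[K]} (hπ : Irreducible π) :
    Isometry (quotientDigitEval π hπ) :=
  AddMonoidHomClass.isometry_of_norm _ (norm_quotientDigitEval hπ)

end Isometry

/-! ### Surjectivity -/

section Surjectivity

variable {K : Type*} [NontriviallyNormedField K] [IsUltrametricDist K] [LocallyCompactSpace K]

theorem finite_teichmuller :
    Finite {z : 𝒪[K] // z ^ Nat.card 𝓀[K] = z} := by
  obtain ⟨hdvr, hfin⟩ := localField_dvr_and_finite (K := K)
  obtain ⟨π, hπ⟩ := IsDiscreteValuationRing.exists_irreducible 𝒪[K]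
  refine Finite.of_injective (fun z => IsLocalRing.residue 𝒪[K] z.1) fun z w h => Subtype.ext ?_
  exact teichmuller_eq_of_norm_lt hπ z.2 w.2 ((residue_eq_iff_norm _ _).mp h)

/-- A continuous function on `𝒪[K]` is approximated by functions of the first `n` digits, and these
are polynomials in the digits by Lagrange interpolation on the Teichmüller representatives. -/
theorem denseRange_digitEval {π : 𝒪[K]} (hπ : Irreducible π) : DenseRange (digitEval π hπ) := by
  classical
  have := finite_teichmuller (K := K)
  have := Fintype.ofFinite {z : 𝒪[K] // z ^ Nat.card 𝓀[K] = z}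
  refine Metric.denseRange_iff.mpr fun g ε hε => ?_
  obtain ⟨δ, hδ, hg⟩ := Metric.uniformContinuous_iff.mp
    (CompactSpace.uniformContinuous_of_continuous g.continuous) (ε / 2) (half_pos hε)
  obtain ⟨n, hn⟩ := exists_pow_lt_of_lt_one hδ (Valued.integer.norm_irreducible_lt_one hπ)
  -- the Lagrange basis polynomial equal to `1` at `t` and `0` at the other representatives
  let v : {z : 𝒪[K] // z ^ Nat.card 𝓀[K] = z} → K := fun t => t.1
  let L : {z : 𝒪[K] // z ^ Nat.card 𝓀[K] = z} → Polynomial K :=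
    Lagrange.basis Finset.univ v
  have hL : ∀ s t, (L t).eval (s.1 : K) = if t = s then 1 else 0 := by
    intro s t
    split_ifs with h
    · rw [h]
      exact Lagrange.eval_basis_self (v := v)
        (fun a _ b _ hab => Subtype.ext (Subtype.ext hab)) (Finset.mem_univ s)
    · exact Lagrange.eval_basis_of_ne (v := v) h (Finset.mem_univ s)
  -- the element of `𝒪[K]` whose first `n` digits are given by `a` and whose other digits vanish
  let c : (Fin n → {z : 𝒪[K] // z ^ Nat.card 𝓀[K] = z}) → 𝒪[K] :=
    fun a => ∑ j, (a j).1 * π ^ (j : ℕ)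
  refine ⟨∑ a, g (c a) • ∏ j : Fin n, Polynomial.aeval (TateAlgebra.X (j : ℕ)) (L (a j)), ?_⟩
  refine ((ContinuousMap.dist_le (half_pos hε).le).mpr fun x => ?_).trans_lt (half_lt_self hε)
  have hx := isTeichmullerExpansion_teichmullerDigit hπ x
  let ax : Fin n → {z : 𝒪[K] // z ^ Nat.card 𝓀[K] = z} :=
    fun j => ⟨teichmullerDigit π hπ j x, hx.1 j⟩
  have hval : digitEval π hπ (∑ a, g (c a) •
      ∏ j : Fin n, Polynomial.aeval (TateAlgebra.X (j : ℕ)) (L (a j))) x = g (c ax) := by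
    have haeval : ∀ (p : Polynomial K) (j : Fin n),
        Polynomial.aeval (digitMap π hπ (j : ℕ)) p x = p.eval ((ax j).1 : K) := fun p j =>
      (Polynomial.aeval_algHom_apply (ContinuousMap.evalAlgHom K K x) _ p).symm
    simp only [map_sum, map_smul, map_prod, ← Polynomial.aeval_algHom_apply, digitEval_X,
      ContinuousMap.sum_apply, ContinuousMap.smul_apply, ContinuousMap.prod_apply, haeval, hL]
    rw [Finset.sum_eq_single ax]
    · simp
    · intro a _ ha
      obtain ⟨j, hj⟩ := Function.ne_iff.mp ha
      rw [Finset.prod_eq_zero (Finset.mem_univ j) (if_neg hj), smul_zero]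
    · exact fun h => absurd (Finset.mem_univ _) h
  rw [hval]
  obtain ⟨y, hy⟩ := hx.exists_eq_sum_range_add hπ n
  refine (hg (lt_of_le_of_lt ?_ hn)).le
  have hxc : x - c ax = π ^ n * y := by
    nth_rewrite 1 [hy]
    rw [← Fin.sum_univ_eq_sum_range (fun j => teichmullerDigit π hπ j x * π ^ j)]
    exact add_sub_cancel_left _ _
  rw [dist_eq_norm, hxc, norm_mul, norm_pow]
  exact mul_le_of_le_one_right (by positivity) (Valued.integer.norm_le_one y)

theorem bijective_quotientDigitEval {π : 𝒪[K]} (hπ : Irreducible π) :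
    Function.Bijective (quotientDigitEval π hπ) := by
  have : CompleteSpace K := completeSpace_of_locallyCompactSpace
  have hiso := isometry_quotientDigitEval hπ
  refine ⟨hiso.injective, fun g => ?_⟩
  have hclosed := hiso.isClosedEmbedding.isClosed_range
  refine hclosed.closure_subset_iff.mpr ?_ (denseRange_digitEval hπ g)
  rintro _ ⟨f, rfl⟩
  exact ⟨Ideal.Quotient.mk _ f, quotientDigitEval_mk hπ f⟩

end Surjectivity

/-! ### Dependence on the uniformizer -/

section Uniformizer

variable {K : Type*} [NontriviallyNormedField K] [IsUltrametricDist K] [LocallyCompactSpace K]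

/-- A uniformizer is determined by its digit functions: the digits of `π` with respect to `π` are
`0, 1, 0, 0, …`. -/
theorem eq_of_teichmullerDigit_eq {π ϖ : 𝒪[K]} (hπ : Irreducible π) (hϖ : Irreducible ϖ)
    (h : ∀ j x, teichmullerDigit π hπ j x = teichmullerDigit ϖ hϖ j x) : π = ϖ := by
  have hq : Nat.card 𝓀[K] ≠ 0 := (one_lt_card_residueField (K := K)).ne_bot
  have hexp : ∀ ρ : 𝒪[K], IsTeichmullerExpansion ρ ρ fun j => if j = 1 then 1 else 0 := by
    refine fun ρ => ⟨fun j => ?_, ?_⟩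
    · dsimp only
      split_ifs <;> simp [hq]
    · convert hasSum_ite_eq 1 ρ using 2 with j
      split_ifs with hj <;> simp [hj]
  have h1 : HasSum (fun j => (if j = 1 then 1 else 0 : 𝒪[K]) * ϖ ^ j) π := by
    simp only [(hexp π).eq_teichmullerDigit hπ, h]
    exact (isTeichmullerExpansion_teichmullerDigit hϖ π).2
  exact h1.unique (hexp ϖ).2

end Uniformizer

theorem theorem6p2 (K : Type*) [NontriviallyNormedField K] [IsUltrametricDist K]
    [LocallyCompactSpace K] :
    (∃ π : 𝒪[K], Irreducible π) ∧
    CompleteSpace (TateAlgebra K ⧸ TateAlgebra.frobeniusIdeal K (Nat.card 𝓀[K])) ∧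
    ∃ Ψ : {π : 𝒪[K] // Irreducible π} →
        ((TateAlgebra K ⧸ TateAlgebra.frobeniusIdeal K (Nat.card 𝓀[K])) ≃ₐ[K] C(𝒪[K], K)),
      (∀ π, Isometry (Ψ π) ∧
        ∀ (j : ℕ) (x : 𝒪[K]),
          Ψ π (Ideal.Quotient.mk _ (TateAlgebra.X j)) x =
            (teichmullerDigit π.1 π.2 j x : K)) ∧
      Function.Injective Ψ := by
  have : CompleteSpace K := completeSpace_of_locallyCompactSpace
  have := (localField_dvr_and_finite (K := K)).1
  have hX : ∀ (π : {π : 𝒪[K] // Irreducible π}) (j : ℕ) (x : 𝒪[K]),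
      quotientDigitEval π.1 π.2 (Ideal.Quotient.mk _ (TateAlgebra.X j)) x =
        (teichmullerDigit π.1 π.2 j x : K) := fun π j x => by
    rw [quotientDigitEval_mk, digitEval_X, digitMap_apply]
  refine ⟨IsDiscreteValuationRing.exists_irreducible 𝒪[K], inferInstance,
    fun π => AlgEquiv.ofBijective (quotientDigitEval π.1 π.2) (bijective_quotientDigitEval π.2),
    fun π => ⟨isometry_quotientDigitEval π.2, hX π⟩, fun π ϖ h => Subtype.ext ?_⟩
  refine eq_of_teichmullerDigit_eq π.2 ϖ.2 fun j x => Subtype.ext ?_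
  rw [← hX, ← hX]
  exact DFunLike.congr_fun (DFunLike.congr_fun h (Ideal.Quotient.mk _ (TateAlgebra.X j))) x
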